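/- Write $\omega^\omega$ for the set of functions $\omega\to\omega$. For $h\in\omega^\omega$, a global $(\omega,h)$-predictor is a function $\pi$ on $\bigcup_{n<\omega}\omega^n$ such that $\pi(\sigma)\subseteq\omega$ and $|\pi(\sigma)|\le h(n)$ for all $n<\omega$ and $\sigma\in\omega^n$. For an infinite $D\subseteq\omega$ and $f\in\omega^\omega$, $\pi$ predicts $f$ on $D$ if $f(n)\in\pi(f\restriction n)$ for all but finitely many $n\in D$. Define - $\mathfrak{pr}^G_{\omega,h}$: the least size of a set $\Pi$ of global $(\omega,h)$-predictors such that every $f\in\omega^\omega$ is predicted on $\omega$ by some $\pi\in\Pi$; - $\mathfrak{pr}^L_{\omega,h}$: the least size of a set $\Pi$ of pairs $(D,\pi)$, with $D\subseteq\omega$ infinite and $\pi$ a global $(\omega,h)$-predictor, such that for every $f\in\omega^\omega$ there is $(D,\pi)\in\Pi$ such that $\pi$ predicts $f$ on $D$; - $\mathfrak{pr}^I_{\omega,h}$: the least size of a set $\Pi$ of global $(\omega,h)$-predictors such that for every $f\in\omega^\omega$ there are $\pi\in\Pi$ and an infinite $D\subseteq\omega$ such that $\pi$ predicts $f$ on $D$.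 A number in place of $h$ stands for the constant function. Let $\mathfrak{pr}$ be the least size of a set $\Pi$ of pairs $(D,\langle\pi_n:n\in D\rangle)$, with $D\subseteq\omega$ infinite and $\pi_n\colon\omega^n\to\omega$, such that for every $f\in\omega^\omega$ there is such a pair in $\Pi$ with $f(n)=\pi_n(f\restriction n)$ for all but finitely many $n\in D$. Let $\mathcal M$ and $\mathcal N$ be the ideals of meager sets and of null sets (for the standard product measure) of $2^\omega$, and let $\mathrm{cov}(\mathcal M)$ be the least size of a family of members of $\mathcal M$ with union $2^\omega$, $\mathrm{non}(\mathcal M)$ the least size of a subset of $2^\omega$ not in $\mathcal M$, and $\mathrm{cof}(\mathcal N)$ the least size of a family $\mathcal B\subseteq\mathcal N$ such that every member of $\mathcal N$ is a subset of a member of $\mathcal B$. **Lemma.** Let $2\le k<\omega$ and let $h\in\omega^\omega$ go to infinity. Then 1. $2^{\aleph_0}=\mathfrak{pr}^G_{\omega,1}\ge\mathfrak{pr}^G_{\omega,k}\ge\mathrm{cof}(\mathcal N)=\mathfrak{pr}^G_{\omega,h}$; 2. $\mathfrak{pr}^L_{\omega,1}=\mathfrak{pr}\ge\mathfrak{pr}^L_{\omega,k}\ge\mathfrak{pr}^L_{\omega,h}$,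 and $\mathfrak{pr}^L_{\omega,h}\ge\mathrm{cov}(\mathcal M)$ and $\mathfrak{pr}^L_{\omega,h}\ge\mathrm{non}(\mathcal M)$; 3. $\mathfrak{pr}^I_{\omega,1}=\mathfrak{pr}^I_{\omega,k}=\mathfrak{pr}^I_{\omega,h}=\mathrm{non}(\mathcal M)$. -/

import Mathlib

namespace SlalomPrediction

/-! ### Relational systems -/

/-- A relational system `⟨X, Y, ⊏⟩`: non-empty sets of challenges and responses, and a relation. -/
structure RelationalSystem where
  X : Type
  Y : Type
  nonemptyX : Nonempty X
  nonemptyY : Nonempty Y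
  rel : X → Y → Prop

/-- `F` is dominating if every challenge is met by some response in `F`. -/
def RelationalSystem.IsDominating (R : RelationalSystem) (F : Set R.Y) : Prop :=
  ∀ x : R.X, ∃ y ∈ F, R.rel x y

/-- `𝔡(R)`, the least cardinality of a dominating set of responses. -/
noncomputable def RelationalSystem.dd (R : RelationalSystem) : Cardinal.{0} :=
  sInf {c | ∃ F : Set R.Y, R.IsDominating F ∧ Cardinal.mk F = c}

/-! ### Slalom prediction on `ω^ω` -/

/-- The initial segment `f ↾ n`. -/
def restr (f : ℕ → ℕ) (n : ℕ) : Fin n → ℕ := fun i => f i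

/-- A global `(ω, h)`-predictor: to each finite sequence of length `n` it assigns a set of at most
`h n` natural numbers. -/
structure GlobalPredictor (h : ℕ → ℕ) where
  guess : (n : ℕ) → (Fin n → ℕ) → Finset ℕ
  card_le : ∀ n (σ : Fin n → ℕ), (guess n σ).card ≤ h n

/-- A local `(ω, h)`-predictor: an infinite set `D` together with a global predictor. -/
structure LocalPredictor (h : ℕ → ℕ) where
  D : Set ℕ
  infinite : D.Infinite
  pred : GlobalPredictor h

/-- `f(n) ∈ π(f ↾ n)` for all but finitely many `n ∈ D`. -/
def GlobalPredictor.PredictsOn {h : ℕ → ℕ} (p : GlobalPredictor h) (D : Set ℕ) (f : ℕ → ℕ) :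
    Prop :=
  {n ∈ D | f n ∉ p.guess n (restr f n)}.Finite

/-- `π` predicts `f`. -/
def GlobalPredictor.Predicts {h : ℕ → ℕ} (p : GlobalPredictor h) (f : ℕ → ℕ) : Prop :=
  p.PredictsOn Set.univ f

/-- `π` infinitely predicts `f`. -/
def GlobalPredictor.InfinitelyPredicts {h : ℕ → ℕ} (p : GlobalPredictor h) (f : ℕ → ℕ) : Prop :=
  ∃ D : Set ℕ, D.Infinite ∧ p.PredictsOn D f

/-- `(D, π)` predicts `f`. -/
def LocalPredictor.Predicts {h : ℕ → ℕ} (p : LocalPredictor h) (f : ℕ → ℕ) : Prop :=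
  p.pred.PredictsOn p.D f

/-- The global predictor that never guesses anything. -/
def GlobalPredictor.empty (h : ℕ → ℕ) : GlobalPredictor h where
  guess := fun _ _ => ∅
  card_le := fun _ _ => by simp

theorem GlobalPredictor.nonempty (h : ℕ → ℕ) : Nonempty (GlobalPredictor h) :=
  ⟨GlobalPredictor.empty h⟩

theorem LocalPredictor.nonempty (h : ℕ → ℕ) : Nonempty (LocalPredictor h) :=
  ⟨⟨Set.univ, Set.infinite_univ, GlobalPredictor.empty h⟩⟩

/-- The relational system `GPr(ω, h)`. -/
def GPr (h : ℕ → ℕ) : RelationalSystem where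
  X := ℕ → ℕ
  Y := GlobalPredictor h
  nonemptyX := inferInstance
  nonemptyY := GlobalPredictor.nonempty h
  rel := fun f p => p.Predicts f

/-- The relational system `LPr(ω, h)`. -/
def LPr (h : ℕ → ℕ) : RelationalSystem where
  X := ℕ → ℕ
  Y := LocalPredictor h
  nonemptyX := inferInstance
  nonemptyY := LocalPredictor.nonempty h
  rel := fun f p => p.Predicts f

/-- The relational system `IPr(ω, h)`. -/
def IPr (h : ℕ → ℕ) : RelationalSystem where
  X := ℕ → ℕ
  Y := GlobalPredictor h
  nonemptyX := inferInstance
  nonemptyY := GlobalPredictor.nonempty h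
  rel := fun f p => p.InfinitelyPredicts f

/-- The global prediction number `𝔭𝔯^G_{ω,h}`. -/
noncomputable def prG (h : ℕ → ℕ) : Cardinal.{0} := (GPr h).dd

/-- The local prediction number `𝔭𝔯^L_{ω,h}`. -/
noncomputable def prL (h : ℕ → ℕ) : Cardinal.{0} := (LPr h).dd

/-- The infinite prediction number `𝔭𝔯^I_{ω,h}`. -/
noncomputable def prI (h : ℕ → ℕ) : Cardinal.{0} := (IPr h).dd

/-! ### Blass's prediction number -/

/-- A predictor `(D, ⟨π_n : n ∈ D⟩)`: `D ⊆ ω` is infinite and `π_n : ω^n → ω`. -/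
structure Predictor where
  D : Set ℕ
  infinite : D.Infinite
  guess : (n : D) → (Fin (n : ℕ) → ℕ) → ℕ

/-- `f(n) = π_n(f ↾ n)` for all but finitely many `n ∈ D`. -/
def Predictor.Predicts (p : Predictor) (f : ℕ → ℕ) : Prop :=
  {n : p.D | f n ≠ p.guess n (restr f n)}.Finite

/-- The prediction number `𝔭𝔯`. -/
noncomputable def pr : Cardinal.{0} :=
  sInf {c | ∃ P : Set Predictor, (∀ f : ℕ → ℕ, ∃ p ∈ P, p.Predicts f) ∧ Cardinal.mk P = c}

/-! ### Cardinal invariants of ideals -/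

/-- `cov(I)`: the least size of a subfamily of `I` that covers the space. -/
noncomputable def cov {S : Type} (I : Set (Set S)) : Cardinal.{0} :=
  sInf {c | ∃ C : Set (Set S), C ⊆ I ∧ ⋃₀ C = Set.univ ∧ Cardinal.mk C = c}

/-- `non(I)`: the least size of a subset of the space that does not belong to `I`. -/
noncomputable def non {S : Type} (I : Set (Set S)) : Cardinal.{0} :=
  sInf {c | ∃ A : Set S, A ∉ I ∧ Cardinal.mk A = c}

/-- `cof(I)`: the least size of a subfamily of `I` that is cofinal with respect to inclusion. -/
noncomputable def cof {S : Type} (I : Set (Set S)) : Cardinal.{0} :=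
  sInf {c | ∃ B : Set (Set S), B ⊆ I ∧ (∀ A ∈ I, ∃ b ∈ B, A ⊆ b) ∧ Cardinal.mk B = c}

/-- The standard (fair coin) product measure on the Cantor space `2^ω`. -/
noncomputable def cantorMeasure : MeasureTheory.Measure (ℕ → Bool) :=
  MeasureTheory.Measure.infinitePi (fun _ : ℕ => (PMF.uniformOfFintype Bool).toMeasure)

/-- The ideal `𝓜` of meager subsets of `2^ω`. -/
def meagerIdeal : Set (Set (ℕ → Bool)) := {A | IsMeagre A}

/-- The ideal `𝓝` of null subsets of `2^ω`. -/
def nullIdeal : Set (Set (ℕ → Bool)) := {A | cantorMeasure A = 0}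

end SlalomPrediction

namespace SlalomPrediction

open Filter Set Cardinal Topology MeasureTheory
open scoped ENNReal

/-! ### Generalities on dominating numbers -/

/-! The monotonicity claims are Tukey connections: prediction ignores finitely many places, so
eventual inequalities between bounds suffice.

A predictor with one guess predicts only countably many functions, since such a function is
determined by an initial segment; hence the value `2 ^ ℵ₀`.

For `cof nullIdeal` the link is Bartoszyński's passage between null sets and slaloms. The sequences
predicted from a fixed start form a finitely branching tree, whose levels give a slalom
(`GlobalPredictor.slalom`). If the captured function codes small clopen sets, the slalom yields a
null set (`exists_null_of_slalom`). Conversely, `f` yields the null limsup of independent events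
`rowEvent n (f n)`. A null set containing it yields countably many slaloms, one of which captures
`f` (`exists_slaloms_of_null`). Applied to codes of initial segments, these become predictors whose
width grows as slowly as `h` requires.

For category, `firstTrue` turns a Cohen-generic point into a function that meets every given
function infinitely often and evades every local predictor. The hard inequality is `non meagerIdeal
≤ prI h`: predictors are converted by Hall's theorem into functions that guess infinitely often on
every infinite set (`exists_family_frequently_eq`), and gluing pairs of these produces a nonmeager
set. -/

theorem RelationalSystem.dd_le {R : RelationalSystem} {F : Set R.Y} (hF : R.IsDominating F) :
    R.dd ≤ #F :=
  csInf_le' ⟨F, hF, rfl⟩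

/-- Since `sInf ∅ = 0`, the infimum is attained only when some dominating set exists. This is the
source of the hypothesis that eventually `1 ≤ h n`. -/
theorem RelationalSystem.exists_isDominating_mk_eq {R : RelationalSystem}
    (hR : ∀ x, ∃ y, R.rel x y) : ∃ F : Set R.Y, R.IsDominating F ∧ #F = R.dd :=
  csInf_mem (s := {c | ∃ F : Set R.Y, R.IsDominating F ∧ #F = c})
    ⟨_, univ, fun x => (hR x).imp fun _ hy => ⟨mem_univ _, hy⟩, rfl⟩

/-- A Tukey connection compares dominating numbers. -/
theorem RelationalSystem.dd_le_dd {R S : RelationalSystem} (hS : ∀ x, ∃ y, S.rel x y)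
    (φ : R.X → S.X) (ψ : S.Y → R.Y) (hφψ : ∀ x y, S.rel (φ x) y → R.rel x (ψ y)) :
    R.dd ≤ S.dd := by
  obtain ⟨F, hF, hc⟩ := RelationalSystem.exists_isDominating_mk_eq hS
  have hd : R.IsDominating (ψ '' F) := fun x => by
    obtain ⟨y, hy, hxy⟩ := hF (φ x)
    exact ⟨ψ y, mem_image_of_mem _ hy, hφψ _ _ hxy⟩
  exact hc ▸ (RelationalSystem.dd_le hd).trans mk_image_le

/-! ### Basic properties of predictors -/

theorem GlobalPredictor.predictsOn_iff {h : ℕ → ℕ} {p : GlobalPredictor h} {D : Set ℕ}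
    {f : ℕ → ℕ} :
    p.PredictsOn D f ↔ ∀ᶠ n in atTop, n ∈ D → f n ∈ p.guess n (restr f n) := by
  rw [← Nat.cofinite_eq_atTop, eventually_cofinite, GlobalPredictor.PredictsOn]
  simp only [Classical.not_imp]

theorem GlobalPredictor.predicts_iff {h : ℕ → ℕ} {p : GlobalPredictor h} {f : ℕ → ℕ} :
    p.Predicts f ↔ ∀ᶠ n in atTop, f n ∈ p.guess n (restr f n) := by
  simp [GlobalPredictor.Predicts, GlobalPredictor.predictsOn_iff]

theorem GlobalPredictor.infinitelyPredicts_iff {h : ℕ → ℕ} {p : GlobalPredictor h} {f : ℕ → ℕ} :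
    p.InfinitelyPredicts f ↔ ∃ᶠ n in atTop, f n ∈ p.guess n (restr f n) := by
  constructor
  · rintro ⟨D, hD, hp⟩
    rw [GlobalPredictor.predictsOn_iff] at hp
    exact ((Nat.frequently_atTop_iff_infinite.2 hD).and_eventually hp).mono fun n hn => hn.2 hn.1
  · intro hf
    refine ⟨_, Nat.frequently_atTop_iff_infinite.1 hf, ?_⟩
    rw [GlobalPredictor.predictsOn_iff]
    exact .of_forall fun n hn => hn

/-- The predictor that always guesses the value of `f`, where `h` allows it. -/
def GlobalPredictor.ofFun (h f : ℕ → ℕ) : GlobalPredictor h where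
  guess n _ := if 1 ≤ h n then {f n} else ∅
  card_le n σ := by split_ifs <;> simp [*]

theorem GlobalPredictor.ofFun_predicts {h : ℕ → ℕ} (hh : ∀ᶠ n in atTop, 1 ≤ h n) (f : ℕ → ℕ) :
    (GlobalPredictor.ofFun h f).Predicts f := by
  rw [GlobalPredictor.predicts_iff]
  filter_upwards [hh] with n hn
  simp [GlobalPredictor.ofFun, hn]

theorem GPr_exists_rel {h : ℕ → ℕ} (hh : ∀ᶠ n in atTop, 1 ≤ h n) (f : (GPr h).X) :
    ∃ p, (GPr h).rel f p :=
  ⟨_, GlobalPredictor.ofFun_predicts hh f⟩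

theorem LPr_exists_rel {h : ℕ → ℕ} (hh : ∀ᶠ n in atTop, 1 ≤ h n) (f : (LPr h).X) :
    ∃ p, (LPr h).rel f p :=
  ⟨⟨univ, infinite_univ, _⟩, GlobalPredictor.ofFun_predicts hh f⟩

theorem IPr_exists_rel {h : ℕ → ℕ} (hh : ∀ᶠ n in atTop, 1 ≤ h n) (f : (IPr h).X) :
    ∃ p, (IPr h).rel f p :=
  ⟨_, univ, infinite_univ, GlobalPredictor.ofFun_predicts hh f⟩

/-- Discard the guesses that are too large for the bound `h'`. -/
def GlobalPredictor.truncate {h : ℕ → ℕ} (h' : ℕ → ℕ) (p : GlobalPredictor h) :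
    GlobalPredictor h' where
  guess n σ := if (p.guess n σ).card ≤ h' n then p.guess n σ else ∅
  card_le n σ := by split_ifs <;> simp [*]

theorem GlobalPredictor.PredictsOn.truncate {h h' : ℕ → ℕ} (hh : ∀ᶠ n in atTop, h n ≤ h' n)
    {p : GlobalPredictor h} {D : Set ℕ} {f : ℕ → ℕ} (hp : p.PredictsOn D f) :
    (p.truncate h').PredictsOn D f := by
  rw [GlobalPredictor.predictsOn_iff] at hp ⊢
  filter_upwards [hp, hh] with n hn hn' hD
  have hle := (p.card_le n (restr f n)).trans hn'
  simpa [GlobalPredictor.truncate, hle] using hn hD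

theorem prG_le_prG {h h' : ℕ → ℕ} (h1 : ∀ᶠ n in atTop, 1 ≤ h n)
    (hh : ∀ᶠ n in atTop, h n ≤ h' n) : prG h' ≤ prG h :=
  RelationalSystem.dd_le_dd (GPr_exists_rel h1) id (GlobalPredictor.truncate h')
    fun _ _ => GlobalPredictor.PredictsOn.truncate hh

theorem prL_le_prL {h h' : ℕ → ℕ} (h1 : ∀ᶠ n in atTop, 1 ≤ h n)
    (hh : ∀ᶠ n in atTop, h n ≤ h' n) : prL h' ≤ prL h :=
  RelationalSystem.dd_le_dd (LPr_exists_rel h1) id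
    (fun p : LocalPredictor h => ⟨p.D, p.infinite, p.pred.truncate h'⟩)
    fun _ _ => GlobalPredictor.PredictsOn.truncate hh

theorem prI_le_prI {h h' : ℕ → ℕ} (h1 : ∀ᶠ n in atTop, 1 ≤ h n)
    (hh : ∀ᶠ n in atTop, h n ≤ h' n) : prI h' ≤ prI h :=
  RelationalSystem.dd_le_dd (IPr_exists_rel h1) id (GlobalPredictor.truncate h')
    fun _ _ ⟨D, hD, hp⟩ => ⟨D, hD, hp.truncate hh⟩

theorem prI_le_prL {h : ℕ → ℕ} (h1 : ∀ᶠ n in atTop, 1 ≤ h n) : prI h ≤ prL h :=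
  RelationalSystem.dd_le_dd (LPr_exists_rel h1) id LocalPredictor.pred
    fun _ (p : LocalPredictor h) hp => ⟨p.D, p.infinite, hp⟩

theorem prI_le_prG {h : ℕ → ℕ} (h1 : ∀ᶠ n in atTop, 1 ≤ h n) : prI h ≤ prG h :=
  RelationalSystem.dd_le_dd (GPr_exists_rel h1) id id fun _ _ hp => ⟨univ, infinite_univ, hp⟩

/-! ### Comparison with Blass's prediction number -/

/-- A predictor as a local predictor with singleton guesses. -/
noncomputable def Predictor.toLocal (p : Predictor) : LocalPredictor fun _ => 1 where
  D := p.D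
  infinite := p.infinite
  pred :=
    { guess := fun n σ => by
        classical exact if hn : n ∈ p.D then {p.guess ⟨n, hn⟩ σ} else ∅
      card_le := fun n σ => by split_ifs <;> simp }

/-- A local predictor with at most one guess as a predictor. -/
noncomputable def LocalPredictor.toPredictor (p : LocalPredictor fun _ => 1) : Predictor where
  D := p.D
  infinite := p.infinite
  -- On a singleton the supremum is its element; on `∅` it is `0`, which is harmless because an
  -- empty guess is never correct.
  guess n σ := (p.pred.guess n σ).sup id

theorem Predictor.Predicts.toLocal {p : Predictor} {f : ℕ → ℕ} (hp : p.Predicts f) :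
    p.toLocal.Predicts f := by
  refine (Set.Finite.image Subtype.val hp).subset ?_
  rintro n ⟨hn : n ∈ p.D, hf⟩
  refine ⟨⟨n, hn⟩, ?_, rfl⟩
  simpa [Predictor.toLocal, hn] using hf

theorem LocalPredictor.Predicts.toPredictor {p : LocalPredictor fun _ => 1} {f : ℕ → ℕ}
    (hp : p.Predicts f) : p.toPredictor.Predicts f := by
  refine (Set.Finite.preimage Subtype.val_injective.injOn hp).subset ?_
  rintro ⟨n, hn⟩ hf
  refine ⟨hn, fun hmem => hf ?_⟩
  have : p.pred.guess n (restr f n) = {f n} :=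
    (Finset.eq_of_subset_of_card_le (Finset.singleton_subset_iff.2 hmem)
      ((p.pred.card_le _ _).trans (by simp))).symm
  simp [LocalPredictor.toPredictor, this]

theorem prL_one_eq_pr : prL (fun _ => 1) = pr := by
  have h1 : ∀ᶠ _ : ℕ in atTop, 1 ≤ 1 := .of_forall fun _ => le_rfl
  apply le_antisymm
  · refine le_csInf ⟨_, univ, fun f => ?_, rfl⟩ ?_
    · obtain ⟨p, hp⟩ := LPr_exists_rel h1 f
      exact ⟨_, mem_univ _, LocalPredictor.Predicts.toPredictor hp⟩
    · rintro c ⟨P, hP, rfl⟩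
      refine (RelationalSystem.dd_le (R := LPr fun _ => 1) (F := Predictor.toLocal '' P)
        fun f => ?_).trans mk_image_le
      obtain ⟨p, hp, hf⟩ := hP f
      exact ⟨_, mem_image_of_mem _ hp, hf.toLocal⟩
  · obtain ⟨F, hF, hc⟩ := RelationalSystem.exists_isDominating_mk_eq (LPr_exists_rel h1)
    refine le_trans (csInf_le' (a := #(LocalPredictor.toPredictor '' F)) ⟨_, fun f => ?_, rfl⟩)
      (mk_image_le.trans hc.le)
    obtain ⟨p, hp, hf⟩ := hF f
    exact ⟨_, mem_image_of_mem _ hp, LocalPredictor.Predicts.toPredictor hf⟩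

/-! ### Global prediction with a single guess -/

theorem restr_succ (f : ℕ → ℕ) (n : ℕ) :
    restr f (n + 1) = Fin.snoc (α := fun _ => ℕ) (restr f n) (f n) := by
  ext i
  refine Fin.lastCases ?_ (fun j => ?_) i <;> simp [restr]

theorem restr_congr {f g : ℕ → ℕ} {n : ℕ} (hfg : ∀ m < n, f m = g m) : restr f n = restr g n :=
  funext fun i => hfg i i.2

/-- Two functions predicted from `N` on with at most one guess at each place agree as soon as they
agree below `N`. -/
theorem GlobalPredictor.eq_of_restr_eq {p : GlobalPredictor fun _ => 1} {f g : ℕ → ℕ} {N : ℕ}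
    (hf : ∀ n ≥ N, f n ∈ p.guess n (restr f n)) (hg : ∀ n ≥ N, g n ∈ p.guess n (restr g n))
    (hfg : restr f N = restr g N) : f = g := by
  funext n
  induction n using Nat.strong_induction_on with
  | _ n ih =>
    rcases lt_or_ge n N with hn | hn
    · exact congrFun hfg ⟨n, hn⟩
    · have h1 := hf n hn
      rw [restr_congr ih] at h1
      exact Finset.card_le_one.1 (p.card_le n _) _ h1 _ (hg n hn)

/-- Split according to the place `N` from which the prediction is correct; each piece injects into
the countable set `Fin N → ℕ`. -/
theorem GlobalPredictor.countable_setOf_predicts (p : GlobalPredictor fun _ => 1) :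
    {f | p.Predicts f}.Countable := by
  have hsub : {f | p.Predicts f} ⊆ ⋃ N, {f | ∀ n ≥ N, f n ∈ p.guess n (restr f n)} := by
    intro f hf
    rw [mem_ofPred_eq, GlobalPredictor.predicts_iff, eventually_atTop] at hf
    exact mem_iUnion.2 hf
  refine (countable_iUnion fun N => ?_).mono hsub
  refine MapsTo.countable_of_injOn (f := fun f => restr f N) (t := univ) (mapsTo_univ _ _) ?_
    (to_countable _)
  intro f hf g hg hfg
  exact GlobalPredictor.eq_of_restr_eq hf hg hfg

theorem two_power_aleph0_eq_prG_one : 2 ^ ℵ₀ = prG (fun _ => 1) := by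
  have h1 : ∀ᶠ _ : ℕ in atTop, 1 ≤ 1 := .of_forall fun _ => le_rfl
  have hX : #(ℕ → ℕ) = 2 ^ ℵ₀ := by simp
  apply le_antisymm
  · obtain ⟨F, hF, hc⟩ := RelationalSystem.exists_isDominating_mk_eq (GPr_exists_rel h1)
    have hcov : (univ : Set (ℕ → ℕ)) ⊆
        ⋃ p : F, {f | GlobalPredictor.Predicts (h := fun _ => 1) p.1 f} := by
      intro f _
      obtain ⟨p, hp, hf⟩ := hF f
      exact mem_iUnion.2 ⟨⟨p, hp⟩, hf⟩
    have hle : (2 : Cardinal) ^ ℵ₀ ≤ #F * ℵ₀ := by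
      rw [← hX, ← mk_univ]
      refine (mk_le_mk_of_subset hcov).trans ((mk_iUnion_le_sum_mk).trans ?_)
      refine (sum_le_sum _ (fun _ => ℵ₀) fun p => ?_).trans (by simp)
      exact le_aleph0_iff_set_countable.2 (GlobalPredictor.countable_setOf_predicts _)
    rw [prG, ← hc]
    by_contra! hlt
    exact absurd hle (not_le.2 (mul_lt_of_lt (cantor ℵ₀).le hlt (cantor ℵ₀)))
  · refine (RelationalSystem.dd_le (R := GPr fun _ => 1)
      (F := range (GlobalPredictor.ofFun fun _ => 1)) fun f =>
        ⟨_, mem_range_self f, GlobalPredictor.ofFun_predicts h1 f⟩).trans ?_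
    exact mk_range_le.trans hX.le

/-! ### Category in the Cantor space -/

theorem isOpen_iff_cylinder {s : Set (ℕ → Bool)} :
    IsOpen s ↔ ∀ x ∈ s, ∃ L, ∀ y : ℕ → Bool, (∀ i < L, y i = x i) → y ∈ s := by
  rw [(PiNat.isTopologicalBasis_cylinders fun _ : ℕ => Bool).isOpen_iff]
  constructor
  · intro hs x hx
    obtain ⟨_, ⟨z, L, rfl⟩, hxz, hsub⟩ := hs x hx
    refine ⟨L, fun y hy => hsub fun i hi => ?_⟩
    rw [hy i hi, hxz i hi]
  · intro hs x hx
    obtain ⟨L, hL⟩ := hs x hx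
    exact ⟨_, ⟨x, L, rfl⟩, PiNat.self_mem_cylinder x L, fun y hy => hL y hy⟩

theorem dense_of_cylinder {s : Set (ℕ → Bool)}
    (hs : ∀ x : ℕ → Bool, ∀ L, ∃ y ∈ s, ∀ i < L, y i = x i) : Dense s := by
  rw [dense_iff_inter_open]
  rintro U hU ⟨x, hx⟩
  obtain ⟨L, hL⟩ := isOpen_iff_cylinder.1 hU x hx
  obtain ⟨y, hys, hy⟩ := hs x L
  exact ⟨y, hL y hy, hys⟩

theorem mem_residual_of_iInter_subset {V : ℕ → Set (ℕ → Bool)} (ho : ∀ m, IsOpen (V m))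
    (hd : ∀ m, Dense (V m)) {C : Set (ℕ → Bool)} (hC : ⋂ m, V m ⊆ C) : C ∈ residual (ℕ → Bool) :=
  mem_of_superset (countable_iInter_mem.2 fun m => residual_of_dense_open (ho m) (hd m)) hC

theorem isMeagre_of_countable {A : Set (ℕ → Bool)} (hA : A.Countable) : IsMeagre A := by
  rw [← biUnion_of_singleton A]
  refine isMeagre_biUnion hA fun x _ => ?_
  refine residual_of_dense_open isOpen_compl_singleton (dense_of_cylinder fun y L => ?_)
  refine ⟨fun m => if m < L then y m else !(x m), fun hx => ?_, fun i hi => by simp [hi]⟩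
  simpa using congrFun hx L

theorem exists_notMem_meagerIdeal_mk_eq :
    ∃ A : Set (ℕ → Bool), A ∉ meagerIdeal ∧ #A = non meagerIdeal := by
  refine csInf_mem (s := {c | ∃ A : Set (ℕ → Bool), A ∉ meagerIdeal ∧ #A = c}) ⟨_, univ, ?_, rfl⟩
  exact not_isMeagre_of_isOpen isOpen_univ univ_nonempty

theorem aleph0_lt_non_meagerIdeal : ℵ₀ < non meagerIdeal := by
  obtain ⟨A, hA, hc⟩ := exists_notMem_meagerIdeal_mk_eq
  rw [← hc]
  by_contra! hle
  exact hA (isMeagre_of_countable (le_aleph0_iff_set_countable.1 hle))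

/-- The function whose value at `n` is the first `j` with `x (n, j) = true`. -/
noncomputable def firstTrue (x : ℕ → Bool) (n : ℕ) : ℕ := sInf {j | x (Nat.pair n j) = true}

theorem firstTrue_eq {x : ℕ → Bool} {n v : ℕ} (hv : x (Nat.pair n v) = true)
    (hlt : ∀ j < v, x (Nat.pair n j) = false) : firstTrue x n = v := by
  refine le_antisymm (Nat.sInf_le hv) (le_csInf ⟨v, hv⟩ fun j hj => ?_)
  by_contra! hjv
  simp_all

theorem apply_pair_firstTrue {x : ℕ → Bool} {n : ℕ} (hx : ∃ j, x (Nat.pair n j) = true) :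
    x (Nat.pair n (firstTrue x n)) = true :=
  Nat.sInf_mem (s := {j | x (Nat.pair n j) = true}) hx

theorem apply_pair_of_lt_firstTrue {x : ℕ → Bool} {n j : ℕ} (hj : j < firstTrue x n) :
    x (Nat.pair n j) = false := by
  simpa using Nat.notMem_of_lt_sInf hj

/-- A finite condition of length `L` leaves every row `n ≥ L` untouched, because `n ≤ Nat.pair n j`.
Such a row can be filled so that its first `true` is at `f n`. -/
theorem frequently_firstTrue_eq_mem_residual (f : ℕ → ℕ) :
    {x | ∃ᶠ n in atTop, firstTrue x n = f n} ∈ residual (ℕ → Bool) := by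
  refine mem_residual_of_iInter_subset (V := fun m => {x | ∃ n ≥ m,
    x (Nat.pair n (f n)) = true ∧ ∀ j < f n, x (Nat.pair n j) = false})
    (fun m => isOpen_iff_cylinder.2 ?_) (fun m => dense_of_cylinder fun x L => ?_) ?_
  · rintro x ⟨n, hn, h1, h2⟩
    refine ⟨Nat.pair n (f n) + 1, fun y hy => ⟨n, hn, ?_, fun j hj => ?_⟩⟩
    · rw [hy _ (Nat.lt_succ_self _), h1]
    · rw [hy _ ((Nat.pair_lt_pair_right n hj).trans (Nat.lt_succ_self _)), h2 j hj]
  · have hL : ∀ j, ¬ Nat.pair (max m L) j < L := fun j =>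
      not_lt.2 ((le_max_right m L).trans (Nat.left_le_pair _ _))
    refine ⟨fun p => if p < L then x p else decide (p.unpair.2 = f (max m L)),
      ⟨max m L, le_max_left _ _, ?_, fun j hj => ?_⟩, fun i hi => by simp [hi]⟩
    · simp [hL]
    · simp [hL, hj.ne]
  · intro x hx
    rw [mem_ofPred_eq, frequently_atTop]
    intro m
    obtain ⟨n, hn, h1, h2⟩ := mem_iInter.1 hx m
    exact ⟨n, hn, firstTrue_eq h1 h2⟩

theorem prI_one_le_non_meagerIdeal : prI (fun _ => 1) ≤ non meagerIdeal := by
  obtain ⟨A, hA, hc⟩ := exists_notMem_meagerIdeal_mk_eq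
  rw [← hc]
  refine le_trans (RelationalSystem.dd_le (R := IPr fun _ => 1)
    (F := (fun x => GlobalPredictor.ofFun _ (firstTrue x)) '' A) fun f => ?_) mk_image_le
  have hex : ∃ x ∈ A, ∃ᶠ n in atTop, firstTrue x n = f n := by
    by_contra hno
    exact hA (mem_of_superset (frequently_firstTrue_eq_mem_residual f)
      fun x hx hxA => hno ⟨x, hxA, hx⟩)
  obtain ⟨x, hxA, hx⟩ := hex
  refine ⟨_, mem_image_of_mem _ hxA, GlobalPredictor.infinitelyPredicts_iff.2 (hx.mono ?_)⟩
  intro n hn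
  simp [GlobalPredictor.ofFun, hn]

theorem LocalPredictor.isMeagre_setOf_predicts {h : ℕ → ℕ} (p : LocalPredictor h) :
    IsMeagre {x | p.Predicts (firstTrue x)} := by
  -- Requiring a `true` in every row up to `n` makes the condition open: an empty row gets the
  -- default value `0`, which no finite part of `x` can confirm.
  refine mem_residual_of_iInter_subset (V := fun m => {x | ∃ n ≥ m, n ∈ p.D ∧
    (∀ i ≤ n, ∃ j, x (Nat.pair i j) = true) ∧
    firstTrue x n ∉ p.pred.guess n (restr (firstTrue x) n)})
    (fun m => isOpen_iff_cylinder.2 ?_) (fun m => dense_of_cylinder fun x L => ?_) ?_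
  · rintro x ⟨n, hn, hD, h1, h2⟩
    refine ⟨(Finset.range (n + 1)).sup (fun i => Nat.pair i (firstTrue x i)) + 1,
      fun y hy => ?_⟩
    have hle : ∀ i ≤ n, ∀ j ≤ firstTrue x i, y (Nat.pair i j) = x (Nat.pair i j) := by
      intro i hi j hj
      refine hy _ (Nat.lt_succ_of_le (le_trans ?_ (Finset.le_sup
        (f := fun i => Nat.pair i (firstTrue x i)) (Finset.mem_range_succ_iff.2 hi))))
      rcases hj.eq_or_lt with rfl | hlt
      · exact le_rfl
      · exact (Nat.pair_lt_pair_right i hlt).le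
    have htrue : ∀ i ≤ n, y (Nat.pair i (firstTrue x i)) = true := fun i hi => by
      rw [hle i hi _ le_rfl, apply_pair_firstTrue (h1 i hi)]
    have heq : ∀ i ≤ n, firstTrue y i = firstTrue x i := fun i hi =>
      firstTrue_eq (htrue i hi) fun j hj => by
        rw [hle i hi j hj.le, apply_pair_of_lt_firstTrue hj]
    refine ⟨n, hn, hD, fun i hi => ⟨_, htrue i hi⟩, ?_⟩
    rwa [heq n le_rfl, restr_congr fun i hi => heq i (le_of_lt hi)]
  · obtain ⟨n, hD, hn⟩ := p.infinite.exists_gt (max m L)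
    -- `x₁` fixes the rows below `n`, hence the finite set of guesses at `n`. Row `n` lies beyond
    -- `L`, so `y` can then be given a value `v` outside that set.
    set x₁ : ℕ → Bool := fun q => if q < L then x q else true with hx₁
    obtain ⟨v, hv⟩ := Infinite.exists_notMem_finset (p.pred.guess n (restr (firstTrue x₁) n))
    set y : ℕ → Bool := fun q => if q < L then x q else
      if q.unpair.1 = n then decide (q.unpair.2 = v) else true with hy
    have hL : ∀ j, ¬ Nat.pair n j < L := fun j =>
      not_lt.2 (((le_max_right m L).trans hn.le).trans (Nat.left_le_pair _ _))
    have hyn : firstTrue y n = v := firstTrue_eq (by simp [hy, hL])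
      fun j hj => by simp [hy, hL, hj.ne]
    have hyi : ∀ i < n, ∀ j, y (Nat.pair i j) = x₁ (Nat.pair i j) := fun i hi j => by
      simp [hy, hx₁, hi.ne]
    have hres : restr (firstTrue y) n = restr (firstTrue x₁) n :=
      restr_congr fun i hi => by simp only [firstTrue, hyi i hi]
    refine ⟨y, ⟨n, (le_max_left m L).trans hn.le, hD, fun i hi => ?_, ?_⟩,
      fun i hi => by simp [hy, hi]⟩
    · rcases hi.eq_or_lt with rfl | hlt
      · exact ⟨v, by simp [hy, hL]⟩
      · exact ⟨L, by simp [hyi i hlt, hx₁, not_lt.2 (Nat.right_le_pair i L)]⟩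
    · rwa [hyn, hres]
  · intro x hx hpx
    obtain ⟨m, hm⟩ := eventually_atTop.1 (GlobalPredictor.predictsOn_iff.1 hpx)
    obtain ⟨n, hn, hD, -, hn'⟩ := mem_iInter.1 hx m
    exact hn' (hm n hn hD)

theorem cov_meagerIdeal_le_prL {h : ℕ → ℕ} (h1 : ∀ᶠ n in atTop, 1 ≤ h n) :
    cov meagerIdeal ≤ prL h := by
  obtain ⟨F, hF, hc⟩ := RelationalSystem.exists_isDominating_mk_eq (LPr_exists_rel h1)
  have hle : cov meagerIdeal ≤
      #((fun p : LocalPredictor h => {x | p.Predicts (firstTrue x)}) '' F) := by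
    refine csInf_le' ⟨_, ?_, eq_univ_of_forall fun x => ?_, rfl⟩
    · rintro _ ⟨p, -, rfl⟩
      exact p.isMeagre_setOf_predicts
    · obtain ⟨p, hp, hx⟩ := hF (firstTrue x)
      exact ⟨_, mem_image_of_mem _ hp, hx⟩
  exact hle.trans (mk_image_le.trans hc.le)

/-! ### Infinite prediction and nonmeager sets -/

/-- Hall's theorem: a finite set of indices with maximum `M` has at most `M + 1` elements, and `Q M`
alone is that large. The padding by `Finset.range (c + 1)` makes this hold at every index. -/
theorem exists_injective_forall_mem (P : ℕ → Finset ℕ) :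
    ∃ k : ℕ → ℕ, Function.Injective k ∧ ∀ c, c < (P c).card → k c ∈ P c := by
  let Q : ℕ → Finset ℕ := fun c => if c < (P c).card then P c else Finset.range (c + 1)
  have hQ : ∀ c, c + 1 ≤ (Q c).card := fun c => by
    simp only [Q]
    split_ifs with hc
    · exact hc
    · simp
  obtain ⟨k, hk, hkQ⟩ := (Finset.all_card_le_biUnion_card_iff_exists_injective Q).1 fun s => by
    rcases s.eq_empty_or_nonempty with rfl | hs
    · simp
    · calc s.card ≤ (Finset.range (s.max' hs + 1)).card := Finset.card_le_card fun c hc =>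
            Finset.mem_range_succ_iff.2 (s.le_max' c hc)
        _ ≤ (Q (s.max' hs)).card := (Finset.card_range _).trans_le (hQ _)
        _ ≤ _ := Finset.card_le_card (Finset.subset_biUnion_of_mem Q (s.max'_mem hs))
  refine ⟨k, hk, fun c hc => ?_⟩
  simpa [Q, hc] using hkQ c

/-- The function that follows the rule `R`. -/
def ofRule (R : (n : ℕ) → (Fin n → ℕ) → ℕ) : ℕ → ℕ
  | n => R n fun i => ofRule R i
termination_by n => n
decreasing_by exact i.2

theorem ofRule_apply (R : (n : ℕ) → (Fin n → ℕ) → ℕ) (n : ℕ) :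
    ofRule R n = R n (restr (ofRule R) n) := by
  rw [ofRule]
  rfl

/-- From a family of global predictors that infinitely predicts everything one gets a family of
functions, no larger, that guesses every function infinitely often on every infinite set. -/
theorem exists_family_frequently_eq {h : ℕ → ℕ} {F : Set (GlobalPredictor h)}
    (hF : ∀ f, ∃ p ∈ F, p.InfinitelyPredicts f) :
    ∃ Y : Set (ℕ → ℕ), #Y ≤ #F ∧ ∀ (x : ℕ → ℕ) (X : Set ℕ), X.Infinite →
      ∃ y ∈ Y, {n ∈ X | y n = x n}.Infinite := by
  obtain ⟨d, hd⟩ := exists_surjective_nat (Finset ℕ × (ℕ →₀ ℕ))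
  let code : (n : ℕ) → (Fin n → ℕ) → ℕ → ℕ := fun n σ j =>
    Encodable.encode ((⟨n, σ⟩, j) : (Σ n, Fin n → ℕ) × ℕ)
  have hslot : ∀ p : GlobalPredictor h, ∃ P : ℕ → Finset ℕ × (ℕ →₀ ℕ), ∀ n σ, ∀ a ∈ p.guess n σ,
      ∃ j < h n, P (code n σ j) = d a := by
    intro p
    refine ⟨fun c => match (Encodable.decode c : Option ((Σ n, Fin n → ℕ) × ℕ)) with
      | some s => d ((p.guess s.1.1 s.1.2).toList.getD s.2 0)
      | none => d 0, fun n σ a ha => ?_⟩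
    obtain ⟨j, hj, rfl⟩ := List.getElem_of_mem (Finset.mem_toList.2 ha)
    refine ⟨j, ?_, ?_⟩
    · rw [Finset.length_toList] at hj
      exact hj.trans_le (p.card_le n σ)
    · simp only [code, Encodable.encodek]
      rw [List.getD_eq_getElem _ _ hj]
  choose P hP using hslot
  choose k hkinj hk using fun p => exists_injective_forall_mem fun c => (P p c).1
  -- Each slot `c` holds one guess of `p`, read as a finite partial function. If its domain has more
  -- than `c` points, the slot may fix `y` at one of them, `k p c`, and distinct slots fix distinct
  -- points.
  let y : GlobalPredictor h → ℕ → ℕ := fun p =>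
    Function.extend (k p) (fun c => (P p c).2 (k p c)) 0
  refine ⟨y '' F, mk_image_le, fun x X hX => ?_⟩
  -- The adversary plays a code for `x` restricted to a subset of `X` larger than the index of every
  -- slot that can hold a guess at `σ`. A correct guess then forces `y` to agree with `x` somewhere
  -- on `X`.
  have hrule : ∀ n (σ : Fin n → ℕ), ∃ a, (∀ j < h n, code n σ j < (d a).1.card) ∧
      ∀ i ∈ (d a).1, i ∈ X ∧ (d a).2 i = x i := by
    intro n σ
    obtain ⟨s, hsX, hs⟩ := hX.exists_subset_card_eq ((Finset.range (h n)).sup (code n σ) + 1)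
    obtain ⟨a, ha⟩ := hd (s, Finsupp.indicator s fun i _ => x i)
    refine ⟨a, fun j hj => ?_, fun i hi => ?_⟩
    · rw [ha, hs]
      exact Nat.lt_succ_of_le (Finset.le_sup (f := code n σ) (Finset.mem_range.2 hj))
    · rw [ha] at hi ⊢
      exact ⟨hsX hi, Finsupp.indicator_of_mem (f := fun i _ => x i) hi⟩
  choose R hRcard hR using hrule
  obtain ⟨p, hp, hf⟩ := hF (ofRule R)
  rw [GlobalPredictor.infinitelyPredicts_iff, Nat.frequently_atTop_iff_infinite] at hf
  refine ⟨y p, mem_image_of_mem _ hp, ?_⟩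
  choose! j hjlt hj using fun n (hn : n ∈ {n | ofRule R n ∈ p.guess n (restr (ofRule R) n)}) =>
    hP p n _ _ hn
  refine infinite_of_injOn_mapsTo (f := fun n => k p (code n (restr (ofRule R) n) (j n)))
    ?_ ?_ hf
  · intro n _ m _ hnm
    have := Encodable.encode_injective (hkinj p hnm)
    simp only [Prod.mk.injEq, Sigma.mk.injEq] at this
    exact this.1.1
  · intro n hn
    have hmem := hk p (code n (restr (ofRule R) n) (j n)) (by
      rw [hj n hn, ofRule_apply]
      exact hRcard n _ _ (hjlt n hn))
    rw [hj n hn, ofRule_apply] at hmem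
    refine ⟨(hR n _ _ hmem).1, ?_⟩
    simp only [y]
    rw [(hkinj p).extend_apply, hj n hn, ofRule_apply]
    exact (hR n _ _ hmem).2

/-! ### Nonmeager sets by gluing along interval partitions -/

/-- For a dense open set `U` and `a` there is a pattern on some `[a, b)` that forces membership
in `U`. -/
theorem exists_pattern {U : Set (ℕ → Bool)} (ho : IsOpen U) (hd : Dense U) (a : ℕ) :
    ∃ (b : ℕ) (x : ℕ → Bool), ∀ z : ℕ → Bool, (∀ m, a ≤ m → m < b → z m = x m) → z ∈ U := by
  let flip : Finset ℕ → (ℕ → Bool) → ℕ → Bool := fun s x m => xor (x m) (decide (m ∈ s))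
  have hinv : ∀ s, Function.Involutive (flip s) := fun s x => by simp [flip]
  have hcont : ∀ s, Continuous (flip s) := fun s => continuous_pi fun m =>
    (continuous_of_discreteTopology (f := fun b => xor b (decide (m ∈ s)))).comp
      (continuous_apply m)
  let e : Finset ℕ → (ℕ → Bool) ≃ₜ (ℕ → Bool) := fun s =>
    { (hinv s).toPerm with
      continuous_toFun := hcont s
      continuous_invFun := hcont s }
  -- Intersecting the translates of `U` by all changes below `a` makes the resulting pattern
  -- independent of the first `a` coordinates.
  have hWd : Dense (⋂ s ∈ (Finset.range a).powerset, flip s ⁻¹' U) :=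
    dense_biInter_of_isOpen (S := ((Finset.range a).powerset : Set (Finset ℕ)))
      (fun s _ => ho.preimage (hcont s)) (Finset.countable_toSet _)
      fun s _ => hd.preimage (e s).isOpenMap
  have hWo : IsOpen (⋂ s ∈ (Finset.range a).powerset, flip s ⁻¹' U) :=
    isOpen_biInter_finset fun s _ => ho.preimage (hcont s)
  obtain ⟨x, hx⟩ := hWd.nonempty
  obtain ⟨b, hb⟩ := isOpen_iff_cylinder.1 hWo x hx
  refine ⟨b, x, fun z hz => ?_⟩
  let s : Finset ℕ := (Finset.range a).filter fun m => z m ≠ x m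
  have hzs : flip s z ∈ ⋂ s ∈ (Finset.range a).powerset, flip s ⁻¹' U := by
    refine hb _ fun i hi => ?_
    by_cases hia : i < a
    · by_cases hzx : z i = x i
      · simp [flip, s, hia, hzx]
      · simp [flip, s, hia, hzx]
        revert hzx
        cases z i <;> cases x i <;> simp
    · simp [flip, s, hia, hz i (not_lt.1 hia) hi]
  have := mem_iInter₂.1 hzs s (Finset.mem_powerset.2 (Finset.filter_subset _ _))
  rwa [mem_preimage, hinv s z] at this

/-- The endpoints of an interval partition whose intervals are as long as `φ` demands. -/
def endpoints (φ : ℕ → ℕ) : ℕ → ℕ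
  | 0 => 0
  | n + 1 => (Finset.range (endpoints φ n + 1)).sup φ + endpoints φ n + 1

theorem endpoints_strictMono (φ : ℕ → ℕ) : StrictMono (endpoints φ) :=
  strictMono_nat_of_lt_succ fun n => by rw [endpoints]; omega

theorem apply_le_endpoints_succ {φ : ℕ → ℕ} {m n : ℕ} (hm : m ≤ endpoints φ n) :
    φ m ≤ endpoints φ (n + 1) := by
  have := Finset.le_sup (f := φ) (Finset.mem_range_succ_iff.2 hm)
  rw [Nat.succ_eq_add_one] at this
  rw [endpoints]
  omega

/-- The index of the interval of the partition with endpoints `e` that contains `m`. -/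
noncomputable def blockIndex (e : ℕ → ℕ) (m : ℕ) : ℕ := by
  -- Searching up to `m` suffices: for strictly increasing `e`, `e n ≤ m` implies `n ≤ m`.
  classical exact Nat.findGreatest (fun n => e n ≤ m) m

theorem blockIndex_eq {e : ℕ → ℕ} (he : StrictMono e) {m n : ℕ} (h1 : e n ≤ m)
    (h2 : m < e (n + 1)) : blockIndex e m = n := by
  rw [blockIndex, Nat.findGreatest_eq_iff]
  refine ⟨(he.id_le n).trans h1, fun _ => h1, fun i hi _ hei => ?_⟩
  exact absurd (hei.trans_lt h2) (not_lt.2 (he.monotone hi))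

theorem apply_blockIndex_le {e : ℕ → ℕ} {m : ℕ} (hm : e 0 ≤ m) : e (blockIndex e m) ≤ m := by
  rw [blockIndex]
  exact Nat.findGreatest_spec (P := fun n => e n ≤ m) (Nat.zero_le m) hm

theorem lt_apply_blockIndex_succ {e : ℕ → ℕ} (he : StrictMono e) (m : ℕ) :
    m < e (blockIndex e m + 1) := by
  by_contra! hle
  have hm := he.le_apply.trans hle
  rw [blockIndex] at hle hm
  have := Nat.le_findGreatest (P := fun n => e n ≤ m) hm hle
  omega

/-- The point of the Cantor space put together from the finite sets coded by `y` along the interval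
partition given by `φ`. -/
noncomputable def glue (φ y : ℕ → ℕ) (m : ℕ) : Bool :=
  decide (m ∈ (Encodable.decode (α := Finset ℕ) (y (blockIndex (endpoints φ) m))).getD ∅)

/-- The double `g` pays for one failure: if `[e n, e (n + 1))` contains `m` and is too short, then
`e (n + 1) < g m`. So `g (e (n + 1)) ≤ g (g m) = φ m ≤ e (n + 2)`, and the next interval is long
enough. -/
theorem infinite_setOf_le_endpoints {φ g : ℕ → ℕ} (hg : Monotone g)
    (hφ : {m | φ m = g (g m)}.Infinite) :
    {n | g (endpoints φ n) ≤ endpoints φ (n + 1)}.Infinite := by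
  rw [← Nat.frequently_atTop_iff_infinite, frequently_atTop]
  intro N
  obtain ⟨m, hm, hNm⟩ := hφ.exists_gt (endpoints φ N)
  set n := blockIndex (endpoints φ) m
  have h1 : endpoints φ n ≤ m := apply_blockIndex_le (Nat.zero_le m)
  have h2 : m < endpoints φ (n + 1) := lt_apply_blockIndex_succ (endpoints_strictMono φ) m
  have hn : N ≤ n := Nat.lt_succ_iff.1 ((endpoints_strictMono φ).lt_iff_lt.1 (hNm.trans h2))
  by_cases hle : g (endpoints φ n) ≤ endpoints φ (n + 1)
  · exact ⟨n, hn, hle⟩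
  · by_contra! hno
    have h3 := hno (n + 1) (by omega)
    have h4 : g (endpoints φ (n + 1)) ≤ g (g m) := hg ((not_le.1 hle).le.trans (hg h1))
    have h5 : φ m ≤ endpoints φ (n + 1 + 1) := apply_le_endpoints_succ h2.le
    rw [show φ m = g (g m) from hm] at h5
    omega

theorem glue_image2_notMem_meagerIdeal {Y : Set (ℕ → ℕ)}
    (hY : ∀ (x : ℕ → ℕ) (X : Set ℕ), X.Infinite → ∃ y ∈ Y, {n ∈ X | y n = x n}.Infinite) :
    image2 glue Y Y ∉ meagerIdeal := by
  intro hmem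
  obtain ⟨S, hSo, hSd, hSc, hS⟩ := mem_residual_iff.1
    (show (image2 glue Y Y)ᶜ ∈ residual _ from hmem)
  -- Adding `univ` allows an enumeration even when `S` is empty.
  obtain ⟨V, hV⟩ := (hSc.insert Set.univ).exists_eq_range (insert_nonempty _ _)
  have hVS : ∀ i, V i ∈ insert Set.univ S := fun i => hV ▸ mem_range_self i
  have hVo : ∀ i, IsOpen (V i) := fun i => (hVS i).elim (fun h => h ▸ isOpen_univ) (hSo _)
  have hVd : ∀ i, Dense (V i) := fun i => (hVS i).elim (fun h => h ▸ dense_univ) (hSd _)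
  have hpat : ∀ a, ∃ (b : ℕ) (x : ℕ → Bool), ∀ z : ℕ → Bool,
      (∀ m, a ≤ m → m < b → z m = x m) → z ∈ ⋂ i ∈ Finset.range a, V i := fun a =>
    exists_pattern (isOpen_biInter_finset fun i _ => hVo i)
      (dense_biInter_of_isOpen (S := (Finset.range a : Set ℕ)) (fun i _ => hVo i)
        (Finset.countable_toSet _) fun i _ => hVd i) a
  choose b x hbx using hpat
  let g : ℕ → ℕ := fun a => (Finset.range (a + 1)).sup b
  have hg : Monotone g := fun a a' haa =>
    Finset.sup_mono (Finset.range_subset_range.2 (Nat.succ_le_succ haa))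
  have hbg : ∀ a, b a ≤ g a := fun a => Finset.le_sup (Finset.self_mem_range_succ a)
  obtain ⟨φ, hφY, hφ⟩ := hY (fun m => g (g m)) univ infinite_univ
  have hX := infinite_setOf_le_endpoints hg (by simpa using hφ)
  -- `φ` has supplied infinitely many intervals long enough for a pattern; `y` guesses the pattern
  -- on infinitely many of these. Guessing on the infinite set `hX`, not just on `ℕ`, is essential
  -- here.
  obtain ⟨y, hyY, hy⟩ := hY (fun n => Encodable.encode
    ((Finset.range (endpoints φ (n + 1))).filter fun m => x (endpoints φ n) m = true)) _ hX
  refine hS (mem_sInter.2 fun s hs => ?_) (mem_image2_of_mem hφY hyY)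
  obtain ⟨i, rfl⟩ : s ∈ range V := hV ▸ mem_insert_of_mem _ hs
  obtain ⟨n, ⟨hnX, hyn⟩, hin⟩ := hy.exists_gt i
  have hz : glue φ y ∈ ⋂ i ∈ Finset.range (endpoints φ n), V i := by
    refine hbx _ _ fun m hm1 hm2 => ?_
    have hm3 : m < endpoints φ (n + 1) := hm2.trans_le ((hbg _).trans hnX)
    rw [glue, blockIndex_eq (endpoints_strictMono φ) hm1 hm3, hyn, Encodable.encodek]
    simp [hm3]
  exact mem_iInter₂.1 hz i (Finset.mem_range.2 (hin.trans_le ((endpoints_strictMono φ).id_le n)))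

theorem non_meagerIdeal_le_prI {h : ℕ → ℕ} (h1 : ∀ᶠ n in atTop, 1 ≤ h n) :
    non meagerIdeal ≤ prI h := by
  obtain ⟨F, hF, hc⟩ := RelationalSystem.exists_isDominating_mk_eq (IPr_exists_rel h1)
  obtain ⟨Y, hYF, hY⟩ := exists_family_frequently_eq hF
  have hle : non meagerIdeal ≤ #F * #F :=
    calc non meagerIdeal ≤ #(image2 glue Y Y) :=
          csInf_le' ⟨_, glue_image2_notMem_meagerIdeal hY, rfl⟩
      _ = #((fun q : (ℕ → ℕ) × (ℕ → ℕ) => glue q.1 q.2) '' (Y ×ˢ Y)) := by rw [image_prod]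
      _ ≤ #(Y ×ˢ Y) := mk_image_le
      _ = #Y * #Y := mk_setProd _ _
      _ ≤ #F * #F := mul_le_mul' hYF hYF
  rw [prI, ← hc]
  rcases lt_or_ge #F ℵ₀ with hlt | hge
  -- Uncountability of `non meagerIdeal` rules out finite `F`, so the square is absorbed.
  · exact absurd (aleph0_lt_non_meagerIdeal.trans_le hle) (not_lt.2 (mul_lt_aleph0 hlt hlt).le)
  · rwa [mul_eq_self hge] at hle

/-! ### The measure on the Cantor space -/

instance : IsProbabilityMeasure cantorMeasure := by
  unfold cantorMeasure
  infer_instance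

theorem measurableSet_forall_lt_true (n : ℕ) :
    MeasurableSet {x : ℕ → Bool | ∀ j < n, x j = true} := by
  have : {x : ℕ → Bool | ∀ j < n, x j = true} = ⋂ j, ⋂ (_ : j < n), (fun x => x j) ⁻¹' {true} := by
    ext
    simp
  rw [this]
  exact .iInter fun j => .iInter fun _ => measurable_pi_apply j (measurableSet_singleton _)

theorem cantorMeasure_cylinder (x : ℕ → Bool) (n : ℕ) :
    cantorMeasure {y | ∀ j < n, y j = x j} = 2⁻¹ ^ n := by
  have : {y : ℕ → Bool | ∀ j < n, y j = x j} =
      Set.pi (Finset.range n : Set ℕ) fun j => {x j} := by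
    ext
    simp [Set.mem_pi]
  rw [this, cantorMeasure, Measure.infinitePi_pi _ fun _ _ => measurableSet_singleton _]
  simp

theorem cantorMeasure_singleton (x : ℕ → Bool) : cantorMeasure {x} = 0 := by
  refine le_antisymm (ge_of_tendsto' (ENNReal.tendsto_pow_atTop_nhds_zero_of_lt_one
    (r := 2⁻¹) (by simp)) fun n => ?_) zero_le
  rw [← cantorMeasure_cylinder x n]
  exact measure_mono fun y hy j _ => by rw [mem_singleton_iff.1 hy]

/-- The `i`-th of infinitely many independent events of probability `2⁻ⁿ`. -/
def rowEvent (n i : ℕ) : Set (ℕ → Bool) := {x | ∀ j < n, x (Nat.pair i j) = true}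

theorem isOpen_rowEvent (n i : ℕ) : IsOpen (rowEvent n i) := by
  have : rowEvent n i = ⋂ j ∈ Finset.range n, (fun x => x (Nat.pair i j)) ⁻¹' {true} := by
    ext
    simp [rowEvent]
  rw [this]
  exact isOpen_biInter_finset fun j _ => (isOpen_discrete _).preimage (continuous_apply _)

/-- The rows of a random point are independent random points; all independence of the events
`rowEvent n i` comes from this. -/
theorem map_rows_cantorMeasure :
    cantorMeasure.map (fun x i j => x (Nat.pair i j)) =
      Measure.infinitePi fun _ : ℕ => cantorMeasure := by
  have h1 := Measure.map_infinitePi_infinitePi_of_inj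
    (P := fun _ : ℕ => (PMF.uniformOfFintype Bool).toMeasure)
    (f := fun q : ℕ × ℕ => Nat.pair q.1 q.2) Nat.pairEquiv.injective
  have h2 := Measure.infinitePi_map_curry (ι := ℕ) (κ := ℕ) (X := Bool)
    (fun _ _ => (PMF.uniformOfFintype Bool).toMeasure)
  simp only [cantorMeasure]
  rw [← h2, ← h1, Measure.map_map]
  · rfl
  all_goals fun_prop

theorem cantorMeasure_iInter_compl_rowEvent (n : ℕ) (s : Finset ℕ) :
    cantorMeasure (⋂ i ∈ s, (rowEvent n i)ᶜ) = (1 - 2⁻¹ ^ n) ^ s.card := by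
  have hpre : ⋂ i ∈ s, (rowEvent n i)ᶜ = (fun x : ℕ → Bool => fun i j => x (Nat.pair i j)) ⁻¹'
      (Set.pi (s : Set ℕ) fun _ => {x : ℕ → Bool | ∀ j < n, x j = true}ᶜ) := by
    ext x
    simp [rowEvent, Set.mem_pi]
  have hm := (measurableSet_forall_lt_true n).compl
  rw [hpre, ← Measure.map_apply (by fun_prop) (.pi s.countable_toSet fun _ _ => hm),
    map_rows_cantorMeasure, Measure.infinitePi_pi _ fun _ _ => hm, Finset.prod_const,
    prob_compl_eq_one_sub (measurableSet_forall_lt_true n), cantorMeasure_cylinder fun _ => true]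

theorem cantorMeasure_rowEvent (n i : ℕ) : cantorMeasure (rowEvent n i) = 2⁻¹ ^ n := by
  have h := cantorMeasure_iInter_compl_rowEvent n {i}
  have h1 : (2⁻¹ : ℝ≥0∞) ^ n ≤ 1 := pow_le_one' (by simp) n
  simp only [Finset.mem_singleton, iInter_iInter_eq_left, Finset.card_singleton, pow_one,
    prob_compl_eq_one_sub (isOpen_rowEvent n i).measurableSet] at h
  rw [← ENNReal.sub_sub_cancel ENNReal.one_ne_top h1, ← h,
    ENNReal.sub_sub_cancel ENNReal.one_ne_top prob_le_one]

theorem cantorMeasure_limsup_rowEvent (f : ℕ → ℕ) :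
    cantorMeasure {x | ∃ᶠ n in atTop, x ∈ rowEvent n (f n)} = 0 := by
  refine measure_setOfPred_frequently_eq_zero (p := fun n x => x ∈ rowEvent n (f n)) ?_
  simp only [ofPred_mem_eq, cantorMeasure_rowEvent]
  simp [ENNReal.tsum_geometric]

/-- `1 - t ≤ exp (-t)` bounds the power by `exp (-2⁻ⁿ · 4ⁿ) = exp (-2ⁿ)`, which explains the width
`4 ^ n` of the slaloms. -/
theorem tendsto_one_sub_pow_pow :
    Tendsto (fun n : ℕ => (1 - 2⁻¹ ^ n : ℝ≥0∞) ^ (4 ^ n + 1)) atTop (𝓝 0) := by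
  have hexp : Tendsto (fun n : ℕ => Real.exp (-(2 ^ n : ℝ))) atTop (𝓝 0) :=
    Real.tendsto_exp_neg_atTop_nhds_zero.comp (tendsto_pow_atTop_atTop_of_one_lt one_lt_two)
  have hexp' := ENNReal.tendsto_ofReal hexp
  rw [ENNReal.ofReal_zero] at hexp'
  refine tendsto_of_tendsto_of_tendsto_of_le_of_le tendsto_const_nhds hexp' (fun _ => zero_le)
    fun n => ?_
  have h0 : (0 : ℝ) ≤ 1 - 2⁻¹ ^ n := sub_nonneg.2 (pow_le_one₀ (by norm_num) (by norm_num))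
  have hcast : (1 - 2⁻¹ ^ n : ℝ≥0∞) = ENNReal.ofReal (1 - 2⁻¹ ^ n) := by
    rw [ENNReal.ofReal_sub _ (by positivity), ENNReal.ofReal_one,
      ENNReal.ofReal_pow (by positivity), ENNReal.ofReal_inv_of_pos two_pos, ENNReal.ofReal_ofNat]
  dsimp only
  rw [hcast, ← ENNReal.ofReal_pow h0]
  refine ENNReal.ofReal_le_ofReal ?_
  calc (1 - 2⁻¹ ^ n : ℝ) ^ (4 ^ n + 1) ≤ (1 - 2⁻¹ ^ n) ^ 4 ^ n :=
        pow_le_pow_of_le_one h0 (by simp) (Nat.le_succ _)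
    _ ≤ Real.exp (-2⁻¹ ^ n) ^ 4 ^ n := pow_le_pow_left₀ h0 (Real.one_sub_le_exp_neg _) _
    _ = Real.exp (-(2 ^ n : ℝ)) := by
        rw [← Real.exp_nat_mul]
        congr 1
        push_cast
        rw [show (4 : ℝ) = 2 * 2 by norm_num, mul_pow, inv_pow]
        field_simp

/-! ### Slaloms and predictors from null sets -/

theorem exists_finset_card_le_of_forall_subset {Q : Set ℕ} {N : ℕ}
    (hQ : ∀ s : Finset ℕ, (s : Set ℕ) ⊆ Q → s.card ≤ N) :
    ∃ t : Finset ℕ, t.card ≤ N ∧ (t : Set ℕ) = Q := by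
  have hfin : Q.Finite := by
    by_contra hinf
    obtain ⟨s, hs, hc⟩ := Set.Infinite.exists_subset_card_eq hinf (N + 1)
    have := hQ s hs
    omega
  exact ⟨hfin.toFinset, hQ _ (by simp), by simp⟩

/-- A set of positive measure is almost disjoint from few of the events `rowEvent n i`. -/
theorem exists_slalom_of_measure_ne_zero {K : Set (ℕ → Bool)} (hK : cantorMeasure K ≠ 0) :
    ∃ S : ℕ → Finset ℕ, (∀ n, (S n).card ≤ 4 ^ n) ∧
      ∀ᶠ n in atTop, ∀ i, cantorMeasure (K ∩ rowEvent n i) = 0 → i ∈ S n := by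
  have hev : ∀ᶠ n : ℕ in atTop, ∃ t : Finset ℕ, t.card ≤ 4 ^ n ∧
      (t : Set ℕ) = {i | cantorMeasure (K ∩ rowEvent n i) = 0} := by
    filter_upwards [tendsto_one_sub_pow_pow.eventually_lt_const (pos_iff_ne_zero.2 hK)] with n hn
    refine exists_finset_card_le_of_forall_subset fun s hs => ?_
    by_contra! hcard
    refine absurd hn (not_lt.2 ?_)
    -- If `K` almost missed `4 ^ n + 1` independent events, it would almost lie in the intersection
    -- of their complements, which is too small.
    calc cantorMeasure K ≤ cantorMeasure (K \ ⋃ i ∈ s, K ∩ rowEvent n i) := by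
          rw [measure_sdiff_null]
          exact (measure_biUnion_null_iff s.countable_toSet).2 fun i hi => hs hi
      _ ≤ cantorMeasure (⋂ i ∈ s, (rowEvent n i)ᶜ) := measure_mono fun x hx =>
          mem_iInter₂.2 fun i hi hxi => hx.2 (mem_biUnion hi ⟨hx.1, hxi⟩)
      _ = (1 - 2⁻¹ ^ n) ^ s.card := cantorMeasure_iInter_compl_rowEvent n s
      _ ≤ (1 - 2⁻¹ ^ n) ^ (4 ^ n + 1) := pow_le_pow_right_of_le_one' tsub_le_self hcard
  have hex : ∀ n : ℕ, ∃ t : Finset ℕ, t.card ≤ 4 ^ n ∧ ((∃ t : Finset ℕ, t.card ≤ 4 ^ n ∧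
      (t : Set ℕ) = {i | cantorMeasure (K ∩ rowEvent n i) = 0}) →
      ∀ i, cantorMeasure (K ∩ rowEvent n i) = 0 → i ∈ t) := by
    intro n
    by_cases h : ∃ t : Finset ℕ, t.card ≤ 4 ^ n ∧
      (t : Set ℕ) = {i | cantorMeasure (K ∩ rowEvent n i) = 0}
    · obtain ⟨t, ht, hti⟩ := h
      exact ⟨t, ht, fun _ i hi => Finset.mem_coe.1 (hti ▸ hi)⟩
    · exact ⟨∅, by simp, fun h' => absurd h' h⟩
  choose S hS hS' using hex
  exact ⟨S, hS, hev.mono fun n hn => hS' n hn⟩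

theorem exists_surjective_clopens :
    ∃ e : ℕ → TopologicalSpace.Clopens (ℕ → Bool), Function.Surjective e :=
  have : Countable (TopologicalSpace.Clopens (ℕ → Bool)) :=
    TopologicalSpace.Clopens.countable_iff_secondCountable.2 inferInstance
  exists_surjective_nat _

theorem exists_clopens_mem_subset {U : Set (ℕ → Bool)} (hU : IsOpen U) {x : ℕ → Bool}
    (hx : x ∈ U) : ∃ V : TopologicalSpace.Clopens (ℕ → Bool), x ∈ V ∧ (V : Set (ℕ → Bool)) ⊆ U := by
  obtain ⟨V, hV, hxV, hVU⟩ :=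
    (isTopologicalBasis_isClopen (X := ℕ → Bool)).exists_subset_of_mem_open hx hU
  exact ⟨⟨V, hV⟩, hxV, hVU⟩

/-- A null set determines countably many slaloms, one of which captures `f` whenever the null set
contains the limit superior of the events `rowEvent n (f n)`. -/
theorem exists_slaloms_of_null {A : Set (ℕ → Bool)} (hA : cantorMeasure A = 0) :
    ∃ S : ℕ → ℕ → Finset ℕ, (∀ l n, (S l n).card ≤ 4 ^ n) ∧
      ∀ f : ℕ → ℕ, {x | ∃ᶠ n in atTop, x ∈ rowEvent n (f n)} ⊆ A →
        ∃ l, ∀ᶠ n in atTop, f n ∈ S l n := by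
  obtain ⟨V, hAV, hVo, hV⟩ := A.exists_isOpen_lt_of_lt (μ := cantorMeasure) 1 (by simp [hA])
  obtain ⟨e, he⟩ := exists_surjective_clopens
  have hslalom : ∀ l, ∃ S : ℕ → Finset ℕ, (∀ n, (S n).card ≤ 4 ^ n) ∧
      (cantorMeasure (Vᶜ ∩ e l) ≠ 0 →
        ∀ᶠ n in atTop, ∀ i, cantorMeasure (Vᶜ ∩ e l ∩ rowEvent n i) = 0 → i ∈ S n) := by
    intro l
    by_cases hl : cantorMeasure (Vᶜ ∩ e l) = 0
    · exact ⟨fun _ => ∅, by simp, fun h => absurd hl h⟩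
    · obtain ⟨S, hS, hS'⟩ := exists_slalom_of_measure_ne_zero hl
      exact ⟨S, hS, fun _ => hS'⟩
  choose S hScard hS using hslalom
  refine ⟨S, hScard, fun f hf => ?_⟩
  -- Removing the clopen sets in which `Vᶜ` is null leaves a compact `K` whose nonempty relatively
  -- open pieces all come from non-null parts of `Vᶜ`.
  set Z : Set (ℕ → Bool) := ⋃ l ∈ {l | cantorMeasure (Vᶜ ∩ e l) = 0}, (e l : Set (ℕ → Bool)) with hZ
  have hZo : IsOpen Z := isOpen_biUnion fun l _ => (e l).isOpen
  have hZnull : cantorMeasure (Vᶜ ∩ Z) = 0 := by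
    rw [hZ, inter_iUnion₂]
    exact (measure_biUnion_null_iff (to_countable _)).2 fun l hl => hl
  set K : Set (ℕ → Bool) := Vᶜ \ Z with hK
  have hKc : IsClosed K := hVo.isClosed_compl.sdiff hZo
  have hVpos : cantorMeasure Vᶜ ≠ 0 := by
    rw [prob_compl_eq_one_sub hVo.measurableSet]
    exact (tsub_pos_of_lt hV).ne'
  have hKne : K.Nonempty := by
    rw [nonempty_iff_ne_empty]
    intro hemp
    have hsub : Vᶜ ⊆ Vᶜ ∩ Z := subset_inter Subset.rfl (sdiff_eq_empty.1 hemp)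
    exact hVpos (measure_mono_null hsub hZnull)
  have : CompactSpace K := isCompact_iff_compactSpace.1 hKc.isCompact
  have : Nonempty K := hKne.to_subtype
  let W : ℕ → Set K := fun m => ⋃ n ≥ m, Subtype.val ⁻¹' rowEvent n (f n)
  have hWo : ∀ m, IsOpen (W m) := fun m => isOpen_biUnion fun n _ =>
    (isOpen_rowEvent n (f n)).preimage continuous_subtype_val
  -- Baire category in `K`: if all the open sets `W m` were dense, a point of `K` would lie in the
  -- limsup, hence in `A ⊆ V`.
  have hex : ∃ m, ¬ Dense (W m) := by
    by_contra! hd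
    obtain ⟨x, hx⟩ := (dense_iInter_of_isOpen hWo hd).nonempty
    refine x.2.1 (hAV (hf (frequently_atTop.2 fun m => ?_)))
    simpa [W] using mem_iInter.1 hx m
  obtain ⟨m, hm⟩ := hex
  rw [dense_iff_inter_open] at hm
  push Not at hm
  obtain ⟨_, ⟨O, hO, rfl⟩, ⟨x, hxO⟩, hempty⟩ := hm
  obtain ⟨C, hxC, hCO⟩ := exists_clopens_mem_subset hO hxO
  obtain ⟨l, rfl⟩ := he C
  have hl : cantorMeasure (Vᶜ ∩ e l) ≠ 0 := fun h0 => x.2.2 (mem_biUnion h0 hxC)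
  refine ⟨l, ?_⟩
  filter_upwards [hS l hl, eventually_ge_atTop m] with n hn hmn
  have hsub : Vᶜ ∩ e l ∩ rowEvent n (f n) ⊆ Vᶜ ∩ Z := fun y hy => ⟨hy.1.1, by
    by_contra hyZ
    have hyW : (⟨y, hy.1.1, hyZ⟩ : K) ∈ Subtype.val ⁻¹' O ∩ W m :=
      ⟨hCO hy.1.2, mem_biUnion hmn hy.2⟩
    rw [hempty] at hyW
    exact hyW⟩
  exact hn _ (measure_mono_null hsub hZnull)

theorem exists_cofinal_mk_eq_cof_nullIdeal : ∃ B : Set (Set (ℕ → Bool)), B ⊆ nullIdeal ∧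
    (∀ A ∈ nullIdeal, ∃ b ∈ B, A ⊆ b) ∧ #B = cof nullIdeal :=
  csInf_mem (s := {c | ∃ B : Set (Set (ℕ → Bool)), B ⊆ nullIdeal ∧
    (∀ A ∈ nullIdeal, ∃ b ∈ B, A ⊆ b) ∧ #B = c})
    ⟨_, nullIdeal, Subset.rfl, fun A hA => ⟨A, hA, Subset.rfl⟩, rfl⟩

theorem aleph0_lt_cof_nullIdeal : ℵ₀ < cof nullIdeal := by
  obtain ⟨B, hB, hcof, hc⟩ := exists_cofinal_mk_eq_cof_nullIdeal
  rw [← hc]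
  by_contra! hle
  have hnull : cantorMeasure (⋃₀ B) = 0 :=
    (measure_sUnion_null_iff (le_aleph0_iff_set_countable.1 hle)).2 fun b hb => hB hb
  have hall : ⋃₀ B = Set.univ := eq_univ_of_forall fun x => by
    obtain ⟨b, hb, hxb⟩ := hcof {x} (cantorMeasure_singleton x)
    exact mem_sUnion_of_mem (hxb rfl) hb
  simp [hall] at hnull

/-- The predictor that reads off its guesses from a slalom for codes of initial segments. -/
theorem exists_predictor_of_slalom {h e : ℕ → ℕ} (he : StrictMono e)
    (heh : ∀ k, ∀ m ≥ e k, 4 ^ k ≤ h m) {S : ℕ → Finset ℕ} (hS : ∀ n, (S n).card ≤ 4 ^ n) :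
    ∃ p : GlobalPredictor h, ∀ f : ℕ → ℕ,
      (∀ᶠ k in atTop, Encodable.encode ((List.range (e (k + 1))).map f) ∈ S k) → p.Predicts f := by
  -- The past is ignored: on the block `[e k, e (k + 1))` the guesses are the `m`-th entries of the
  -- at most `4 ^ k ≤ h m` sequences coded in `S k`.
  refine ⟨⟨fun m _ => if e 0 ≤ m then (S (blockIndex e m)).image fun c =>
    ((Encodable.decode (α := List ℕ) c).getD []).getD m 0 else ∅, fun m σ => ?_⟩, fun f hf => ?_⟩
  · split_ifs with hm
    · exact Finset.card_image_le.trans ((hS _).trans (heh _ m (apply_blockIndex_le hm)))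
    · simp
  · rw [GlobalPredictor.predicts_iff]
    obtain ⟨N, hN⟩ := eventually_atTop.1 hf
    filter_upwards [eventually_ge_atTop (e N)] with m hm
    have h0 : e 0 ≤ m := (he.monotone (Nat.zero_le N)).trans hm
    have hlt := lt_apply_blockIndex_succ he m
    have hNk : N ≤ blockIndex e m := Nat.lt_succ_iff.1 (he.lt_iff_lt.1 (hm.trans_lt hlt))
    simp only [h0, if_true, Finset.mem_image]
    refine ⟨_, hN _ hNk, ?_⟩
    rw [Encodable.encodek, Option.getD_some, List.getD_eq_getElem _ _ (by simpa using hlt)]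
    simp

theorem prG_le_cof_nullIdeal {h : ℕ → ℕ} (hh : Tendsto h atTop atTop) :
    prG h ≤ cof nullIdeal := by
  obtain ⟨B, hB, hcof, hc⟩ := exists_cofinal_mk_eq_cof_nullIdeal
  have hk : ∀ k : ℕ, ∀ᶠ N in atTop, ∀ m ≥ N, 4 ^ k ≤ h m := fun k =>
    (eventually_atTop.1 (hh.eventually_ge_atTop (4 ^ k))).elim fun N hN =>
      (eventually_ge_atTop N).mono fun M hM m hm => hN m (hM.trans hm)
  obtain ⟨e, he, heh⟩ := extraction_forall_of_eventually hk
  choose S hScard hS using fun b : B => exists_slaloms_of_null (hB b.2)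
  choose p hp using fun (b : B) l => exists_predictor_of_slalom he heh (hScard b l)
  have hdom : (GPr h).IsDominating (range fun q : B × ℕ => p q.1 q.2) := by
    intro f
    let f' : ℕ → ℕ := fun k => Encodable.encode ((List.range (e (k + 1))).map f)
    obtain ⟨b, hb, hsub⟩ := hcof _ (cantorMeasure_limsup_rowEvent f')
    obtain ⟨l, hl⟩ := hS ⟨b, hb⟩ f' hsub
    exact ⟨_, mem_range_self (⟨b, hb⟩, l), hp _ l f hl⟩
  calc prG h ≤ #(range fun q : B × ℕ => p q.1 q.2) := RelationalSystem.dd_le hdom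
    _ ≤ #(B × ℕ) := mk_range_le
    _ = #B * ℵ₀ := by simp
    _ = cof nullIdeal := by
        rw [hc, mul_aleph0_eq aleph0_lt_cof_nullIdeal.le]

/-! ### Null sets from slaloms -/

theorem exists_clopens_iUnion_eq {U : Set (ℕ → Bool)} (hU : IsOpen U) :
    ∃ E : ℕ → TopologicalSpace.Clopens (ℕ → Bool),
      (⋃ i, (E i : Set (ℕ → Bool)) = U) ∧ ∑' i, cantorMeasure (E i) = cantorMeasure U := by
  classical
  obtain ⟨e, he⟩ := exists_surjective_clopens
  let D : ℕ → Set (ℕ → Bool) := fun i => if (e i : Set (ℕ → Bool)) ⊆ U then e i else ∅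
  have hD : ∀ i, IsClopen (D i) := fun i => by
    simp only [D]
    split_ifs
    exacts [(e i).isClopen, isClopen_empty]
  have hDU : ⋃ i, D i = U := by
    refine Subset.antisymm (iUnion_subset fun i => ?_) fun x hx => ?_
    · simp only [D]
      split_ifs with h
      exacts [h, empty_subset _]
    · obtain ⟨C, hxC, hCU⟩ := exists_clopens_mem_subset hU hx
      obtain ⟨i, rfl⟩ := he C
      exact mem_iUnion.2 ⟨i, by simpa [D, hCU] using hxC⟩
  have hdis : ∀ i, IsClopen (disjointed D i) := fun i =>
    disjointedRec (fun _ j ht => ht.diff (hD j)) (hD i)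
  refine ⟨fun i => ⟨disjointed D i, hdis i⟩, ?_, ?_⟩
  · exact (iUnion_disjointed).trans hDU
  · rw [← hDU, ← iUnion_disjointed, measure_iUnion (disjoint_disjointed D) fun i =>
      (hdis i).isOpen.measurableSet]
    rfl

/-- Cover `A` by open sets of measure below `2⁻ʲ` and split each into disjoint clopen pieces. The
measures are summable, and each point of `A` lies in a piece for every `j`. -/
theorem exists_clopens_frequently_of_null {A : Set (ℕ → Bool)} (hA : cantorMeasure A = 0) :
    ∃ E : ℕ → TopologicalSpace.Clopens (ℕ → Bool), ∑' i, cantorMeasure (E i) ≠ ∞ ∧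
      ∀ x ∈ A, {i | x ∈ E i}.Infinite := by
  have hU : ∀ j : ℕ, ∃ U ⊇ A, IsOpen U ∧ cantorMeasure U < 2⁻¹ ^ j := fun j =>
    A.exists_isOpen_lt_of_lt _ (by rw [hA]; exact ENNReal.pow_pos (by simp) j)
  choose U hAU hUo hUm using hU
  choose E hEU hEm using fun j => exists_clopens_iUnion_eq (hUo j)
  refine ⟨fun q => E q.unpair.1 q.unpair.2, ?_, fun x hx => ?_⟩
  · have h1 : ∑' q : ℕ, cantorMeasure (E q.unpair.1 q.unpair.2) =
        ∑' j, ∑' i, cantorMeasure (E j i) := by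
      rw [← ENNReal.tsum_prod]
      exact Nat.pairEquiv.symm.tsum_eq fun q : ℕ × ℕ => cantorMeasure (E q.1 q.2)
    rw [h1]
    refine ne_top_of_le_ne_top (b := ∑' j : ℕ, (2⁻¹ : ℝ≥0∞) ^ j) (by simp [ENNReal.tsum_geometric])
      (ENNReal.tsum_le_tsum fun j => ?_)
    rw [hEm]
    exact (hUm j).le
  · have hi : ∀ j, ∃ i, x ∈ E j i := fun j => by
      have := hAU j hx
      rw [← hEU j] at this
      exact mem_iUnion.1 this
    choose i hi using hi
    refine infinite_of_injective_forall_mem (f := fun j => Nat.pair j (i j)) ?_ fun j => ?_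
    · intro j j' hjj
      exact (Nat.pair_eq_pair.1 hjj).1
    · simpa using hi j

/-- Every null set is contained in the limit superior of clopen sets of prescribed measure. -/
theorem exists_clopens_measure_le_of_null {A : Set (ℕ → Bool)} (hA : cantorMeasure A = 0)
    {ε : ℕ → ℝ≥0∞} (hε : ∀ n, 0 < ε n) :
    ∃ C : ℕ → TopologicalSpace.Clopens (ℕ → Bool), (∀ n, cantorMeasure (C n) ≤ ε n) ∧
      ∀ x ∈ A, ∃ᶠ n in atTop, x ∈ C n := by
  obtain ⟨E, hEm, hEA⟩ := exists_clopens_frequently_of_null hA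
  have htail := ENNReal.tendsto_sum_nat_add (fun i => cantorMeasure (E i)) hEm
  obtain ⟨e, he, hee⟩ := extraction_forall_of_eventually fun n =>
    htail.eventually_le_const (hε n)
  -- Finite blocks of the summable family: `e n` is chosen so that the tail beyond it has measure at
  -- most `ε n`.
  refine ⟨fun n => (Finset.Ico (e n) (e (n + 1))).sup E, fun n => ?_, fun x hx => ?_⟩
  · refine le_trans ?_ (hee n)
    rw [TopologicalSpace.Clopens.coe_finset_sup]
    refine (measure_biUnion_finset_le _ _).trans ?_
    rw [Finset.sum_Ico_eq_sum_range]
    simp_rw [add_comm (e n)]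
    exact ENNReal.sum_le_tsum _
  · rw [frequently_atTop]
    intro N
    obtain ⟨i, hi, hNi⟩ := (hEA x hx).exists_gt (e N)
    have h0 : e 0 ≤ i := (he.monotone (Nat.zero_le N)).trans hNi.le
    have hlt := lt_apply_blockIndex_succ he i
    refine ⟨blockIndex e i, Nat.lt_succ_iff.1 (he.lt_iff_lt.1 (hNi.trans hlt)), ?_⟩
    have hle : E i ≤ (Finset.Ico (e (blockIndex e i)) (e (blockIndex e i + 1))).sup E :=
      Finset.le_sup (Finset.mem_Ico.2 ⟨apply_blockIndex_le h0, hlt⟩)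
    exact hle hi

/-- Slaloms of width `b` determine null sets so that capturing a suitable function amounts to
covering a given null set. -/
theorem exists_null_of_slalom (b : ℕ → ℕ) : ∃ N : (ℕ → Finset ℕ) → Set (ℕ → Bool),
    (∀ S, (∀ n, (S n).card ≤ b n) → cantorMeasure (N S) = 0) ∧
    ∀ A, cantorMeasure A = 0 → ∃ c : ℕ → ℕ, ∀ S, (∀ n, c n ∈ S n) → A ⊆ N S := by
  obtain ⟨e, he⟩ := exists_surjective_clopens
  -- Small enough that `b n` sets of measure `ε n` have total measure at most `2⁻ⁿ`; the `+ 1`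
  -- avoids division by zero.
  let ε : ℕ → ℝ≥0∞ := fun n => 2⁻¹ ^ n / (b n + 1)
  have hε : ∀ n, 0 < ε n := fun n => ENNReal.div_pos (pow_ne_zero _ (by simp)) (by finiteness)
  refine ⟨fun S => {x | ∃ᶠ n in atTop, ∃ i ∈ S n, cantorMeasure (e i) ≤ ε n ∧ x ∈ e i},
    fun S hS => ?_, fun A hA => ?_⟩
  · refine measure_setOfPred_frequently_eq_zero
      (p := fun n x => ∃ i ∈ S n, cantorMeasure (e i) ≤ ε n ∧ x ∈ e i) ?_
    refine ne_top_of_le_ne_top (b := ∑' j : ℕ, (2⁻¹ : ℝ≥0∞) ^ j) (by simp [ENNReal.tsum_geometric])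
      (ENNReal.tsum_le_tsum fun n => ?_)
    calc cantorMeasure {x | ∃ i ∈ S n, cantorMeasure (e i) ≤ ε n ∧ x ∈ e i}
        ≤ cantorMeasure (⋃ i ∈ S n, {x | cantorMeasure (e i) ≤ ε n ∧ x ∈ e i}) :=
          measure_mono fun x ⟨i, hi, hx⟩ => mem_biUnion hi hx
      _ ≤ ∑ i ∈ S n, cantorMeasure {x | cantorMeasure (e i) ≤ ε n ∧ x ∈ e i} :=
          measure_biUnion_finset_le _ _
      _ ≤ ∑ _i ∈ S n, ε n := Finset.sum_le_sum fun i _ => by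
          by_cases hi : cantorMeasure (e i) ≤ ε n
          · exact (measure_mono fun x hx => hx.2).trans hi
          · simp [hi]
      _ = (S n).card * ε n := by simp
      _ ≤ (b n + 1) * ε n := by
          gcongr
          exact le_trans (mod_cast hS n) le_self_add
      _ = 2⁻¹ ^ n := ENNReal.mul_div_cancel (by simp) (by finiteness)
  · obtain ⟨C, hCm, hCA⟩ := exists_clopens_measure_le_of_null hA hε
    choose c hc using fun n => he (C n)
    refine ⟨c, fun S hS x hx => (hCA x hx).mono fun n hn => ⟨c n, hS n, ?_⟩⟩
    rw [hc]
    exact ⟨hCm n, hn⟩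

/-! ### Slaloms from global predictors -/

/-- The guesses of `p`, replaced by the entries of the list `l` on its length. -/
def GlobalPredictor.startGuess {h : ℕ → ℕ} (p : GlobalPredictor h) (l : List ℕ) (n : ℕ)
    (σ : Fin n → ℕ) : Finset ℕ :=
  if n < l.length then {l.getD n 0} else p.guess n σ

/-- The level `n` of the finitely branching tree of predicted sequences starting with `l`. -/
def GlobalPredictor.level {h : ℕ → ℕ} (p : GlobalPredictor h) (l : List ℕ) :
    (n : ℕ) → Finset (Fin n → ℕ)
  | 0 => Finset.univ
  | n + 1 => (p.level l n).biUnion fun σ =>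
      (p.startGuess l n σ).image fun a => Fin.snoc (α := fun _ => ℕ) σ a

/-- All values at `n` of the branches of the tree of predicted sequences starting with `l`. -/
def GlobalPredictor.slalom {h : ℕ → ℕ} (p : GlobalPredictor h) (l : List ℕ) (n : ℕ) : Finset ℕ :=
  (p.level l n).biUnion (p.startGuess l n)

theorem GlobalPredictor.card_startGuess_le {h : ℕ → ℕ} (p : GlobalPredictor h) (l : List ℕ) (n : ℕ)
    (σ : Fin n → ℕ) : (p.startGuess l n σ).card ≤ max 1 (h n) := by
  rw [GlobalPredictor.startGuess]
  split_ifs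
  · simp
  · exact (p.card_le n σ).trans (le_max_right _ _)

theorem GlobalPredictor.card_level_le {h : ℕ → ℕ} (p : GlobalPredictor h) (l : List ℕ) (n : ℕ) :
    (p.level l n).card ≤ ∏ i ∈ Finset.range n, max 1 (h i) := by
  induction n with
  | zero => simp [GlobalPredictor.level]
  | succ n ih =>
    rw [GlobalPredictor.level, Finset.prod_range_succ]
    exact (Finset.card_biUnion_le_card_mul _ _ _ fun σ _ =>
      Finset.card_image_le.trans (p.card_startGuess_le l n σ)).trans (Nat.mul_le_mul_right _ ih)

theorem GlobalPredictor.card_slalom_le {h : ℕ → ℕ} (p : GlobalPredictor h) (l : List ℕ) (n : ℕ) :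
    (p.slalom l n).card ≤ ∏ i ∈ Finset.range (n + 1), max 1 (h i) := by
  rw [GlobalPredictor.slalom, Finset.prod_range_succ]
  exact (Finset.card_biUnion_le_card_mul _ _ _ fun σ _ => p.card_startGuess_le l n σ).trans
    (Nat.mul_le_mul_right _ (p.card_level_le l n))

theorem GlobalPredictor.Predicts.exists_forall_mem_slalom {h : ℕ → ℕ} {p : GlobalPredictor h}
    {f : ℕ → ℕ} (hf : p.Predicts f) : ∃ l, ∀ n, f n ∈ p.slalom l n := by
  obtain ⟨N, hN⟩ := eventually_atTop.1 (GlobalPredictor.predicts_iff.1 hf)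
  refine ⟨(List.range N).map f, fun n => ?_⟩
  have hguess : ∀ n, f n ∈ p.startGuess ((List.range N).map f) n (restr f n) := by
    intro n
    rw [GlobalPredictor.startGuess]
    split_ifs with hn
    · rw [List.getD_eq_getElem _ _ hn]
      simp
    · exact hN n (by simpa using hn)
  have hlevel : ∀ n, restr f n ∈ p.level ((List.range N).map f) n := by
    intro n
    induction n with
    | zero => exact Finset.mem_univ _
    | succ n ih =>
      rw [GlobalPredictor.level, restr_succ]
      exact Finset.mem_biUnion.2 ⟨_, ih, Finset.mem_image_of_mem _ (hguess n)⟩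
  exact Finset.mem_biUnion.2 ⟨_, hlevel n, hguess n⟩

theorem cof_nullIdeal_le_prG {h : ℕ → ℕ} (h1 : ∀ᶠ n in atTop, 1 ≤ h n) :
    cof nullIdeal ≤ prG h := by
  obtain ⟨F, hF, hc⟩ : ∃ F : Set (GlobalPredictor h), (∀ f, ∃ p ∈ F, p.Predicts f) ∧ #F = prG h :=
    RelationalSystem.exists_isDominating_mk_eq (GPr_exists_rel h1)
  obtain ⟨N, hN, hNA⟩ := exists_null_of_slalom fun n => ∏ i ∈ Finset.range (n + 1), max 1 (h i)
  -- `F` is infinite by the category bound, so the countably many starting lists for each predictor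
  -- do not increase the cardinality.
  have hF0 : ℵ₀ ≤ #F := hc ▸ (aleph0_lt_non_meagerIdeal.trans_le
    ((non_meagerIdeal_le_prI h1).trans (prI_le_prG h1))).le
  let null : F × List ℕ → Set (ℕ → Bool) := fun q => N (q.1.1.slalom q.2)
  have hle : cof nullIdeal ≤ #(range null) := by
    refine csInf_le' ⟨_, ?_, fun A hA => ?_, rfl⟩
    · rintro _ ⟨q, rfl⟩
      exact hN _ (q.1.1.card_slalom_le q.2)
    · obtain ⟨c, hcA⟩ := hNA A hA
      obtain ⟨p, hp, hpc⟩ := hF c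
      obtain ⟨l, hl⟩ := hpc.exists_forall_mem_slalom
      exact ⟨null (⟨p, hp⟩, l), mem_range_self _, hcA _ hl⟩
  calc cof nullIdeal ≤ #(range null) := hle
    _ ≤ #(F × List ℕ) := mk_range_le
    _ = #F * ℵ₀ := by simp
    _ = prG h := by rw [mul_aleph0_eq hF0, hc]

end SlalomPrediction

open SlalomPrediction

theorem mainTheorem10 (k : ℕ) (hk : 2 ≤ k) (h : ℕ → ℕ)
    (hh : Filter.Tendsto h Filter.atTop Filter.atTop) :
    (2 ^ Cardinal.aleph0.{0} = SlalomPrediction.prG (fun _ => 1) ∧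
      SlalomPrediction.prG (fun _ => 1) ≥ SlalomPrediction.prG (fun _ => k) ∧
      SlalomPrediction.prG (fun _ => k) ≥ SlalomPrediction.cof SlalomPrediction.nullIdeal ∧
      SlalomPrediction.cof SlalomPrediction.nullIdeal = SlalomPrediction.prG h) ∧
    (SlalomPrediction.prL (fun _ => 1) = SlalomPrediction.pr ∧
      SlalomPrediction.pr ≥ SlalomPrediction.prL (fun _ => k) ∧
      SlalomPrediction.prL (fun _ => k) ≥ SlalomPrediction.prL h ∧
      SlalomPrediction.prL h ≥ SlalomPrediction.cov SlalomPrediction.meagerIdeal ∧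
      SlalomPrediction.prL h ≥ SlalomPrediction.non SlalomPrediction.meagerIdeal) ∧
    (SlalomPrediction.prI (fun _ => 1) = SlalomPrediction.prI (fun _ => k) ∧
      SlalomPrediction.prI (fun _ => k) = SlalomPrediction.prI h ∧
      SlalomPrediction.prI h = SlalomPrediction.non SlalomPrediction.meagerIdeal) := by
  have hk1 : 1 ≤ k := one_le_two.trans hk
  have h11 : ∀ᶠ _ : ℕ in Filter.atTop, 1 ≤ 1 := .of_forall fun _ => le_rfl
  have h1k : ∀ᶠ _ : ℕ in Filter.atTop, 1 ≤ k := .of_forall fun _ => hk1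
  have hkh : ∀ᶠ n in Filter.atTop, k ≤ h n := hh.eventually_ge_atTop k
  have h1h : ∀ᶠ n in Filter.atTop, 1 ≤ h n := hh.eventually_ge_atTop 1
  -- All infinite prediction numbers are squeezed between `non meagerIdeal` and `prI` for one guess,
  -- which is itself at most `non meagerIdeal`.
  have hI : ∀ {g : ℕ → ℕ}, (∀ᶠ n in Filter.atTop, 1 ≤ g n) → prI g = non meagerIdeal :=
    fun hg => le_antisymm ((prI_le_prI h11 hg).trans prI_one_le_non_meagerIdeal)
      (non_meagerIdeal_le_prI hg)
  refine ⟨⟨two_power_aleph0_eq_prG_one, prG_le_prG h11 h1k, cof_nullIdeal_le_prG h1k,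
    le_antisymm (cof_nullIdeal_le_prG h1h) (prG_le_cof_nullIdeal hh)⟩,
    ⟨prL_one_eq_pr, prL_one_eq_pr ▸ prL_le_prL h11 h1k, prL_le_prL h1k hkh,
      cov_meagerIdeal_le_prL h1h, (non_meagerIdeal_le_prI h1h).trans (prI_le_prL h1h)⟩,
    (hI h11).trans (hI h1k).symm, (hI h1k).trans (hI h1h).symm, hI h1h⟩
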